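/- A sign pattern of degree $d$ is a sequence $\sigma=(\sigma_0,\dots,\sigma_d)$ with each $\sigma_j\in\{+,-\}$. A real polynomial $a_0x^d+a_1x^{d-1}+\cdots+a_d$ of degree $d$ has sign pattern $\sigma$ if, for every $j$, the coefficient $a_j$ is nonzero and has sign $\sigma_j$. Let $p_\sigma$ and $n_\sigma$ be the numbers of sign changes and of sign preservations between consecutive entries of $\sigma$. A pair $(p,n)$ of nonnegative integers is admissible for $\sigma$ if $p\le p_\sigma$, $n\le n_\sigma$, $p\equiv p_\sigma \pmod 2$ and $n\equiv n_\sigma \pmod 2$. A sign pattern $\sigma$ together with an admissible pair $(p,n)$ is realizable if there is a real polynomial of degree $d$ with sign pattern $\sigma$ that has exactly $p$ distinct positive roots and exactly $n$ distinct negative roots. **Theorem.** In degree $8$, none of the following six combinations of a sign pattern and an admissible pair is realizable: 1. $(+,+,+,-,-,-,-,+,+)$ with $(0,6)$; 2. $(+,+,-,+,-,-,-,+,+)$ with $(4,0)$; 3. $(+,+,-,+,-,+,-,-,+)$ with $(4,0)$; 4. $(+,+,+,-,-,+,-,+,+)$ with $(4,0)$; 5. $(+,+,+,+,-,+,-,-,+)$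 with $(4,0)$; 6. $(+,+,-,+,-,-,-,-,+)$ with $(4,0)$. -/

import Mathlib

open Polynomial

/-- A sign pattern of degree `d`: a sequence `(σ₀, …, σ_d)` of signs `±`, encoded as `1` and `-1`. -/
abbrev SignPattern (d : ℕ) : Type := Fin (d + 1) → ℤˣ

namespace SignPattern

/-- The number of sign changes between consecutive components of `σ`. -/
def changes {d : ℕ} (σ : SignPattern d) : ℕ :=
  (Finset.univ.filter fun j : Fin d => σ j.castSucc ≠ σ j.succ).card

/-- The number of sign preservations between consecutive components of `σ`. -/
def preservations {d : ℕ} (σ : SignPattern d) : ℕ :=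
  (Finset.univ.filter fun j : Fin d => σ j.castSucc = σ j.succ).card

/-- The pair `(p, n)` satisfies the restrictions which Descartes' rule of signs imposes on the
numbers of positive and negative roots of a polynomial with sign pattern `σ`. -/
def IsAdmissible {d : ℕ} (σ : SignPattern d) (p n : ℕ) : Prop :=
  p ≤ σ.changes ∧ n ≤ σ.preservations ∧
    p ≡ σ.changes [MOD 2] ∧ n ≡ σ.preservations [MOD 2]

instance {d : ℕ} (σ : SignPattern d) (p n : ℕ) : Decidable (σ.IsAdmissible p n) := by
  unfold IsAdmissible
  infer_instance

/-- The real polynomial `P` has degree `d`, and its coefficients, listed from the leading one down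
to the constant term, have the signs `σ₀, …, σ_d`; in particular none of them vanishes. -/
def IsPatternOf {d : ℕ} (σ : SignPattern d) (P : ℝ[X]) : Prop :=
  P.natDegree = d ∧
    ∀ j : Fin (d + 1), SignType.sign (P.coeff (d - (j : ℕ))) = SignType.sign ((σ j : ℤˣ) : ℤ)

end SignPattern

/-- A combination of a sign pattern of degree `d` and a pair admissible for it. -/
structure SignCase (d : ℕ) where
  pattern : SignPattern d
  pos : ℕ
  neg : ℕ
  admissible : pattern.IsAdmissible pos neg

/-- The combination is realizable: some real polynomial of degree `d` has the given sign pattern,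
exactly `pos` distinct positive roots and exactly `neg` distinct negative roots. -/
def SignCase.Realizable {d : ℕ} (c : SignCase d) : Prop :=
  ∃ P : ℝ[X], c.pattern.IsPatternOf P ∧
    {x : ℝ | 0 < x ∧ P.IsRoot x}.ncard = c.pos ∧
    {x : ℝ | x < 0 ∧ P.IsRoot x}.ncard = c.neg

/-- `(+,+,+,−,−,−,−,+,+)` with `(0,6)`. -/
def octicCase1 : SignCase 8 := ⟨![1, 1, 1, -1, -1, -1, -1, 1, 1], 0, 6, by decide⟩

/-- `(+,+,−,+,−,−,−,+,+)` with `(4,0)`. -/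
def octicCase2 : SignCase 8 := ⟨![1, 1, -1, 1, -1, -1, -1, 1, 1], 4, 0, by decide⟩

/-- `(+,+,−,+,−,+,−,−,+)` with `(4,0)`. -/
def octicCase3 : SignCase 8 := ⟨![1, 1, -1, 1, -1, 1, -1, -1, 1], 4, 0, by decide⟩

/-- `(+,+,+,−,−,+,−,+,+)` with `(4,0)`. -/
def octicCase4 : SignCase 8 := ⟨![1, 1, 1, -1, -1, 1, -1, 1, 1], 4, 0, by decide⟩

/-- `(+,+,+,+,−,+,−,−,+)` with `(4,0)`. -/
def octicCase5 : SignCase 8 := ⟨![1, 1, 1, 1, -1, 1, -1, -1, 1], 4, 0, by decide⟩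

/-- `(+,+,−,+,−,−,−,−,+)` with `(4,0)`. -/
def octicCase6 : SignCase 8 := ⟨![1, 1, -1, 1, -1, -1, -1, -1, 1], 4, 0, by decide⟩

/-! Write `P = Q * R`, where `Q` is the product of `X - C x` over the prescribed roots `x`. In each
case `P` has no zero on the closed half-line opposite these roots and `P.coeff 0 > 0`, so `R` is
positive on the open one. The required sign pattern then contradicts linear relations between the
coefficients of `P` and the values of `R` there.

With four positive roots, the values `R(-t) > 0` serve as certificates. In cases 2 and 4, positive
coefficients in degrees 0, 1, 7, 8 force a positive coefficient in degree 4 (`quartic_core_sqrt`).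
In cases 3, 5, 6, positive coefficients in degrees 0, 5, 7, 8 and a negative one in degree 4 force a
positive one in degree 2 (`quartic_core_ratio`).

In case 1 the cofactor is quadratic; Schur and Newton inequalities for the real-rooted sextic `Q`
show that a negative coefficient in degree 5 forces a positive one in degree 2 (`quadratic_core`).
-/

/-! ### Inequalities for a quartic with positive roots and its cofactor -/

/-- The estimate at `t = √(s₃ / s₁)`, from Newton's inequalities for `s₁, …, s₄`. -/
theorem quartic_core_sqrt {s₁ s₂ s₃ s₄ r₀ r₁ r₂ r₃ r₄ : ℝ} (h₁ : 0 < s₁) (h₂ : 0 < s₂)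
    (h₃ : 0 < s₃) (h₄ : 0 < s₄) (n₂ : 9 * (s₁ * s₃) ≤ 4 * s₂ ^ 2) (n₁ : 8 * s₂ ≤ 3 * s₁ ^ 2)
    (n₃ : 8 * (s₂ * s₄) ≤ 3 * s₃ ^ 2) (hr₀ : 0 < r₀) (hr₄ : 0 < r₄)
    (hR : ∀ t : ℝ, 0 < t → 0 < r₄ * t ^ 4 - r₃ * t ^ 3 + r₂ * t ^ 2 - r₁ * t + r₀)
    (c₇ : 0 < r₃ - s₁ * r₄) (c₁ : 0 < s₄ * r₁ - s₃ * r₀) :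
    0 < r₀ - s₁ * r₁ + s₂ * r₂ - s₃ * r₃ + s₄ * r₄ := by
  -- The multipliers in `key` need `s₃ / s₂ ≤ t ≤ s₂ / s₁`; this `t` is the geometric mean of the
  -- two ends.
  obtain ⟨t, ht, hts⟩ : ∃ t : ℝ, 0 < t ∧ s₃ = s₁ * t ^ 2 := by
    refine ⟨√(s₃ / s₁), Real.sqrt_pos.2 (by positivity), ?_⟩
    rw [Real.sq_sqrt (by positivity)]; field_simp
  subst hts
  have hw : 3 * (s₁ * t) ≤ 2 * s₂ := by
    refine abs_le_of_sq_le_sq' ?_ (by positivity) |>.2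
    nlinarith
  have e₃ : 0 ≤ s₂ * t - s₁ * t ^ 2 := by nlinarith
  have e₁ : 0 ≤ s₂ - s₁ * t := by nlinarith
  have hR' := hR t ht
  -- the coefficient of `r₄`
  have ht1 : 4 * t ≤ s₁ := by
    refine le_of_mul_le_mul_left ?_ h₁
    nlinarith
  have f₄ : 0 ≤ s₄ - s₂ * t ^ 2 + s₁ * (s₂ * t - s₁ * t ^ 2) := by
    have h : 3 * s₁ * s₂ ≤ 4 * (s₂ * (s₁ - t)) := by nlinarith
    have h' : 0 ≤ s₂ * (s₁ - t) - s₁ * (s₁ * t) := by nlinarith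
    nlinarith [mul_nonneg h' ht.le]
  -- the coefficient of `r₀`
  have hs4 : 4 * s₄ ≤ s₁ * t ^ 3 := by
    have : 4 * s₄ * (s₁ * t) ≤ s₁ * t ^ 3 * (s₁ * t) := by nlinarith [mul_le_mul_of_nonneg_right hw h₄.le]
    exact le_of_mul_le_mul_right this (by positivity)
  have f₀ : 0 ≤ s₄ * (t ^ 2 - s₂) + s₁ * t ^ 2 * (s₂ * t - s₁ * t ^ 2) := by
    have h : 0 ≤ s₂ * (s₁ * t ^ 3 - s₄) - (s₁ * t ^ 2) ^ 2 := by
      have h5 : 0 ≤ s₂ * (s₁ * t ^ 3 - 4 * s₄) := mul_nonneg h₂.le (by linarith)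
      have h6 := mul_le_mul_of_nonneg_right hw (by positivity : 0 ≤ s₁ * t ^ 3)
      have h7 : 0 ≤ (s₁ * t ^ 2) ^ 2 := by positivity
      nlinarith
    nlinarith [mul_pos h₄ (pow_pos ht 2)]
  -- The multiple of `R(-t)` matches the `r₂` term; the multiples of the coefficients of degrees 7
  -- and 1 then absorb `r₃` and `r₁`.
  have key : s₄ * t ^ 2 * (r₀ - s₁ * r₁ + s₂ * r₂ - (s₁ * t ^ 2) * r₃ + s₄ * r₄) =
      s₄ * s₂ * (r₄ * t ^ 4 - r₃ * t ^ 3 + r₂ * t ^ 2 - r₁ * t + r₀)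
      + s₄ * t ^ 2 * (s₂ * t - s₁ * t ^ 2) * (r₃ - s₁ * r₄)
      + t * (s₂ - s₁ * t) * (s₄ * r₁ - s₁ * t ^ 2 * r₀)
      + s₄ * t ^ 2 * r₄ * (s₄ - s₂ * t ^ 2 + s₁ * (s₂ * t - s₁ * t ^ 2))
      + r₀ * (s₄ * (t ^ 2 - s₂) + s₁ * t ^ 2 * (s₂ * t - s₁ * t ^ 2)) := by
    ring
  have pos : 0 < s₄ * t ^ 2 * (r₀ - s₁ * r₁ + s₂ * r₂ - (s₁ * t ^ 2) * r₃ + s₄ * r₄) := by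
    rw [key]
    positivity
  exact pos_of_mul_pos_right pos (by positivity)

/-- The estimate at `t = s₂ / s₁`. -/
theorem quartic_core_ratio {s₁ s₂ s₃ s₄ r₀ r₁ r₂ r₃ r₄ : ℝ} (h₁ : 0 < s₁) (h₂ : 0 < s₂)
    (h₄ : 0 < s₄) (hr₄ : 0 < r₄)
    (hA : 0 < s₁ ^ 2 - s₂) (hD : 0 ≤ s₂ ^ 2 - s₁ * s₃) (hG : 0 < s₂ * s₃ - s₁ * s₄)
    (hM : 0 < s₁ ^ 2 * (s₂ ^ 2 - s₁ * s₃ + s₄) - s₂ ^ 3)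
    (hE : (s₁ ^ 2 - s₂) * (s₁ * (s₂ * s₃ - s₁ * s₄) * (s₂ ^ 2 - s₁ * s₃)
      - (s₁ ^ 2 - s₂) ^ 2 * (s₂ * s₄)) ≤ (s₁ ^ 2 * (s₂ ^ 2 - s₁ * s₃ + s₄) - s₂ ^ 3) ^ 2)
    (hR : ∀ t : ℝ, 0 < t → 0 < r₄ * t ^ 4 - r₃ * t ^ 3 + r₂ * t ^ 2 - r₁ * t + r₀)
    (c₇ : 0 < r₃ - s₁ * r₄) (c₅ : 0 < r₁ - s₁ * r₂ + s₂ * r₃ - s₃ * r₄)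
    (c₄ : r₀ - s₁ * r₁ + s₂ * r₂ - s₃ * r₃ + s₄ * r₄ < 0) :
    0 < s₂ * r₀ - s₃ * r₁ + s₄ * r₂ := by
  by_contra! c₂
  -- At this `t`, the `r₂, r₃` part of `R(-t)` is proportional to that of `c₅`, and its `r₁, r₂`
  -- part to that of `c₄`, so each pair cancels at once.
  have ht : 0 < r₄ * s₂ ^ 4 - r₃ * (s₁ * s₂ ^ 3) + r₂ * (s₁ ^ 2 * s₂ ^ 2) - r₁ * (s₁ ^ 3 * s₂)
      + r₀ * s₁ ^ 4 := by
    have h := mul_pos (hR (s₂ / s₁) (by positivity)) (pow_pos h₁ 4)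
    have e : (r₄ * (s₂ / s₁) ^ 4 - r₃ * (s₂ / s₁) ^ 3 + r₂ * (s₂ / s₁) ^ 2 - r₁ * (s₂ / s₁) + r₀)
        * s₁ ^ 4 = r₄ * s₂ ^ 4 - r₃ * (s₁ * s₂ ^ 3) + r₂ * (s₁ ^ 2 * s₂ ^ 2)
          - r₁ * (s₁ ^ 3 * s₂) + r₀ * s₁ ^ 4 := by
      field_simp
    rwa [e] at h
  set A := s₁ ^ 2 - s₂ with hAdef
  set D := s₂ ^ 2 - s₁ * s₃ with hDdef
  set G := s₂ * s₃ - s₁ * s₄ with hGdef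
  set M := s₁ ^ 2 * (D + s₄) - s₂ ^ 3 with hMdef
  have u₅ : s₁ * s₂ * A * r₁ < s₂ ^ 2 * D * r₄ + s₁ ^ 4 * r₀ := by
    have h := mul_pos (mul_pos h₁ (pow_pos h₂ 2)) c₅
    rw [hAdef, hDdef]
    linarith
  have u₄ : s₂ * M * r₄ < s₁ ^ 2 * A * r₀ := by
    have h := mul_pos (mul_pos (pow_pos h₁ 2) h₂) (neg_pos.2 c₄)
    have h7 := mul_nonneg (mul_nonneg (mul_pos h₁ h₂).le hD) c₇.le
    rw [hMdef, hAdef]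
    rw [hDdef] at h7 ⊢
    linarith
  have u₂ : s₁ ^ 2 * (s₂ ^ 3 - s₁ ^ 2 * s₄) * r₀ + s₄ * s₂ ^ 3 * A * r₄ < s₁ ^ 2 * s₂ * G * r₁ := by
    have h := mul_nonneg (mul_pos (pow_pos h₁ 2) (pow_pos h₂ 2)).le (neg_nonneg.2 c₂)
    have h7 := mul_pos (mul_pos (mul_pos h₄ (pow_pos h₂ 3)) h₁) c₇
    have h8 := mul_pos h₄ ht
    rw [hAdef, hGdef]
    linarith
  -- `u₅` bounds `r₁` above and `u₂` bounds it below; eliminating it leaves only `r₀` and `r₄`.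
  have u : s₁ ^ 2 * r₀ * M < r₄ * s₂ * (s₁ * G * D - A ^ 2 * (s₂ * s₄)) := by
    have h5 := mul_lt_mul_of_pos_left u₅ (mul_pos h₁ hG)
    have h2 := mul_lt_mul_of_pos_left u₂ hA
    have id : A * (s₂ ^ 3 - s₁ ^ 2 * s₄) - s₁ ^ 3 * G = s₂ * M := by
      rw [hAdef, hGdef, hMdef, hDdef]; ring
    refine lt_of_mul_lt_mul_left ?_ h₂.le
    have id' : s₂ * (s₁ ^ 2 * r₀ * M) = s₁ ^ 2 * r₀ * (s₂ * M) := by ring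
    rw [id', ← id]
    linarith
  -- `u` and `u₄` bound `r₀ / r₄` from opposite sides; `hE` says exactly that these bounds are
  -- incompatible.
  have v₁ := mul_lt_mul_of_pos_left u hA
  have v₂ := mul_lt_mul_of_pos_left u₄ hM
  have v₃ := mul_le_mul_of_nonneg_left hE (mul_pos hr₄ h₂).le
  linarith

-- In terms of the smallest root and the gaps between consecutive roots, both differences expand
-- with positive coefficients only.
set_option maxRecDepth 100000 in
theorem quartic_esymm_ineq {a b c d : ℝ} (ha : 0 < a) (hab : a < b) (hbc : b < c) (hcd : c < d)
    {s₁ s₂ s₃ s₄ : ℝ} (e₁ : s₁ = a + b + c + d)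
    (e₂ : s₂ = a * b + a * c + a * d + b * c + b * d + c * d)
    (e₃ : s₃ = a * b * c + a * b * d + a * c * d + b * c * d) (e₄ : s₄ = a * b * c * d) :
    0 < s₁ ^ 2 * (s₂ ^ 2 - s₁ * s₃ + s₄) - s₂ ^ 3 ∧
    (s₁ ^ 2 - s₂) * (s₁ * (s₂ * s₃ - s₁ * s₄) * (s₂ ^ 2 - s₁ * s₃)
      - (s₁ ^ 2 - s₂) ^ 2 * (s₂ * s₄)) ≤ (s₁ ^ 2 * (s₂ ^ 2 - s₁ * s₃ + s₄) - s₂ ^ 3) ^ 2 := by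
  obtain ⟨u, hu, rfl⟩ : ∃ u, 0 < u ∧ b = a + u := ⟨b - a, by linarith, by ring⟩
  obtain ⟨v, hv, rfl⟩ : ∃ v, 0 < v ∧ c = a + u + v := ⟨c - (a + u), by linarith, by ring⟩
  obtain ⟨w, hw, rfl⟩ : ∃ w, 0 < w ∧ d = a + u + v + w := ⟨d - (a + u + v), by linarith, by ring⟩
  subst e₁ e₂ e₃ e₄
  constructor
  · ring_nf
    positivity
  · rw [← sub_nonneg]
    ring_nf
    positivity

/-! ### Real-rooted polynomials and their coefficients -/

theorem splits_derivative {f : ℝ[X]} (hf : f.Splits) : f.derivative.Splits := by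
  rw [splits_iff_card_roots] at hf ⊢
  have h₁ := card_roots_le_derivative f
  have h₂ := card_roots' f.derivative
  have h₃ := natDegree_derivative_le f
  have h₄ : f.natDegree = 0 → f.derivative.natDegree = 0 := fun h ↦ by
    rw [eq_C_of_natDegree_eq_zero h]; simp
  lia

theorem splits_reverse {f : ℝ[X]} (hf : f.Splits) : f.reverse.Splits := by
  obtain ⟨m, hm⟩ := splits_iff_exists_multiset.1 hf
  rw [hm, reverse_mul_of_domain, reverse_C]
  refine Splits.C_mul ?_ _
  clear hm
  induction m using Multiset.induction_on with
  | empty => exact Splits.of_natDegree_le_one ((reverse_natDegree_le _).trans (by simp))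
  | cons a m ih =>
    rw [Multiset.map_cons, Multiset.prod_cons, reverse_mul_of_domain]
    refine Splits.mul (Splits.of_natDegree_le_one ?_) ih
    exact (reverse_natDegree_le _).trans (natDegree_X_sub_C_le a)

theorem schur_degree_one {x y z : ℝ} (hx : 0 ≤ x) (hy : 0 ≤ y) (hz : 0 ≤ z) :
    0 ≤ (x + y + z) ^ 3 - 4 * (x + y + z) * (x * y + y * z + z * x) + 9 * (x * y * z) := by
  have key : ∀ x u v : ℝ, 0 ≤ x → 0 ≤ u → 0 ≤ v →
      0 ≤ (x + (x + u) + (x + u + v)) ^ 3 - 4 * (x + (x + u) + (x + u + v)) *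
        (x * (x + u) + (x + u) * (x + u + v) + (x + u + v) * x)
        + 9 * (x * (x + u) * (x + u + v)) := by
    intro x u v hx hu hv
    ring_nf
    positivity
  have sorted : ∀ x y z : ℝ, 0 ≤ x → x ≤ y → y ≤ z →
      0 ≤ (x + y + z) ^ 3 - 4 * (x + y + z) * (x * y + y * z + z * x) + 9 * (x * y * z) := by
    intro x y z hx hxy hyz
    have := key x (y - x) (z - y) hx (by linarith) (by linarith)
    linarith
  rcases le_total x y with h₁ | h₁ <;> rcases le_total y z with h₂ | h₂ <;>
    rcases le_total x z with h₃ | h₃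
  · linarith [sorted x y z hx h₁ h₂]
  · linarith [sorted x y z hx h₁ h₂]
  · linarith [sorted x z y hx h₃ h₂]
  · linarith [sorted z x y hz h₃ h₁]
  · linarith [sorted y x z hy h₁ h₃]
  · linarith [sorted y z x hy h₂ h₃]
  · linarith [sorted z y x hz h₂ h₁]
  · linarith [sorted z y x hz h₂ h₁]

/-- Consequences of real-rootedness for a cubic with positive coefficients. -/
theorem cubic_coeff_ineqs {g : ℝ[X]} (hg : g.Splits) (hd : g.natDegree = 3)
    (hpos : ∀ k ≤ 3, 0 < g.coeff k) :
    0 ≤ g.coeff 2 ^ 3 - 4 * (g.coeff 1 * g.coeff 2 * g.coeff 3) + 9 * (g.coeff 0 * g.coeff 3 ^ 2) ∧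
    3 * (g.coeff 1 * g.coeff 3) ≤ g.coeff 2 ^ 2 ∧
    9 * (g.coeff 0 * g.coeff 3) ≤ g.coeff 1 * g.coeff 2 := by
  have hcard := hg.natDegree_eq_card_roots
  rw [hd, eq_comm, Multiset.card_eq_three] at hcard
  obtain ⟨x, y, z, hr⟩ := hcard
  have hneg : ∀ x ∈ g.roots, x < 0 := by
    intro x hx
    by_contra! h
    have : 0 < g.eval x := by
      rw [eval_eq_sum_range, hd]
      refine Finset.sum_pos' (fun k hk ↦ ?_) ⟨0, by simp, by simpa using hpos 0⟩
      have := hpos k (by simpa [Nat.lt_succ_iff] using hk)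
      positivity
    exact this.ne' (isRoot_of_mem_roots hx)
  have hx := hneg x (by simp [hr])
  have hy := hneg y (by simp [hr])
  have hz := hneg z (by simp [hr])
  have hl := hpos 3 le_rfl
  have hfac := hg.eq_prod_roots
  set l := g.leadingCoeff with hl'
  have hl3 : g.coeff 3 = l := by rw [hl', leadingCoeff, hd]
  have hfac' : g = C l * X ^ 3 + C (l * (-x + -y + -z)) * X ^ 2
      + C (l * (x * y + y * z + z * x)) * X + C (l * (-x * -y * -z)) := by
    rw [hfac, hr]
    simp only [Multiset.insert_eq_cons, Multiset.map_cons, Multiset.map_singleton,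
      Multiset.prod_cons, Multiset.prod_singleton, map_mul, map_add, map_neg]
    ring
  have h0 : g.coeff 0 = l * (-x * -y * -z) := by
    rw [hfac']; simp only [coeff_add, coeff_C_mul, coeff_X_pow, coeff_X, coeff_C]; norm_num
  have h1 : g.coeff 1 = l * (x * y + y * z + z * x) := by
    rw [hfac']; simp only [coeff_add, coeff_C_mul, coeff_X_pow, coeff_X, coeff_C]; norm_num
  have h2 : g.coeff 2 = l * (-x + -y + -z) := by
    rw [hfac']; simp only [coeff_add, coeff_C_mul, coeff_X_pow, coeff_X, coeff_C]; norm_num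
  rw [hl3] at hl
  rw [h0, h1, h2, hl3]
  obtain ⟨u, hu, rfl⟩ : ∃ u, 0 < u ∧ x = -u := ⟨-x, by linarith, by ring⟩
  obtain ⟨v, hv, rfl⟩ : ∃ v, 0 < v ∧ y = -v := ⟨-y, by linarith, by ring⟩
  obtain ⟨w, hw, rfl⟩ : ∃ w, 0 < w ∧ z = -w := ⟨-z, by linarith, by ring⟩
  refine ⟨?_, ?_, ?_⟩
  · have := mul_nonneg (pow_pos hl 3).le (schur_degree_one hu.le hv.le hw.le)
    linarith
  · have : 0 ≤ l ^ 2 * ((u - v) ^ 2 + (v - w) ^ 2 + (w - u) ^ 2) := by positivity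
    linarith
  · have : 0 ≤ l ^ 2 * (u * (v - w) ^ 2 + v * (w - u) ^ 2 + w * (u - v) ^ 2) := by positivity
    linarith

theorem natDegree_eq_of_coeff_pos {g : ℝ[X]} {n : ℕ} (h : g.natDegree ≤ n) (hn : 0 < g.coeff n) :
    g.natDegree = n :=
  le_antisymm h (le_natDegree_of_ne_zero hn.ne')

/-- Derivatives and reversals preserve real-rootedness and cut out cubics carrying four consecutive
coefficients, to which Schur and Newton apply. The last two conclusions say that the two quadratics
of `quadratic_core` are nonnegative at `q₂ / q₃`. -/
theorem sextic_coeff_ineqs {f : ℝ[X]} (hf : f.Splits) (hd : f.natDegree = 6)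
    (hpos : ∀ k ≤ 6, 0 < f.coeff k) :
    f.coeff 4 * f.coeff 3 ≥ f.coeff 5 * f.coeff 2 ∧ f.coeff 1 * f.coeff 3 ≤ f.coeff 2 ^ 2 ∧
    0 ≤ f.coeff 5 * f.coeff 2 ^ 2 - 2 * (f.coeff 4 * f.coeff 3 * f.coeff 2) + f.coeff 3 ^ 3 ∧
    0 ≤ f.coeff 2 ^ 3 - 2 * (f.coeff 1 * f.coeff 2 * f.coeff 3) + f.coeff 0 * f.coeff 3 ^ 2 := by
  have p0 := hpos 0 (by norm_num)
  have p1 := hpos 1 (by norm_num)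
  have p2 := hpos 2 (by norm_num)
  have p3 := hpos 3 (by norm_num)
  have p4 := hpos 4 (by norm_num)
  have p5 := hpos 5 (by norm_num)
  have p6 := hpos 6 (by norm_num)
  -- the cubic carrying the coefficients of degrees `2, …, 5`
  have dd : f.derivative.derivative.natDegree = 4 := by
    refine natDegree_eq_of_coeff_pos ?_ ?_
    · have h₁ := natDegree_derivative_le f
      have h₂ := natDegree_derivative_le f.derivative
      lia
    · simp only [coeff_derivative]; norm_num; positivity
  have c4 (k : ℕ) (hk : k ≤ 4) : f.derivative.derivative.reverse.coeff k
      = f.coeff (6 - k) * (6 - k) * (5 - k) := by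
    rw [coeff_reverse, dd, revAt_le hk, coeff_derivative, coeff_derivative]
    interval_cases k <;> norm_num
  have hg := splits_derivative (splits_reverse (splits_derivative (splits_derivative hf)))
  have g0 : f.derivative.derivative.reverse.derivative.coeff 0 = 20 * f.coeff 5 := by
    rw [coeff_derivative, c4 _ (by norm_num)]; norm_num; ring
  have g1 : f.derivative.derivative.reverse.derivative.coeff 1 = 24 * f.coeff 4 := by
    rw [coeff_derivative, c4 _ (by norm_num)]; norm_num; ring
  have g2 : f.derivative.derivative.reverse.derivative.coeff 2 = 18 * f.coeff 3 := by
    rw [coeff_derivative, c4 _ (by norm_num)]; norm_num; ring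
  have g3 : f.derivative.derivative.reverse.derivative.coeff 3 = 8 * f.coeff 2 := by
    rw [coeff_derivative, c4 _ (by norm_num)]; norm_num; ring
  have gd : f.derivative.derivative.reverse.derivative.natDegree = 3 := by
    refine natDegree_eq_of_coeff_pos ?_ (by rw [g3]; positivity)
    have h₁ := natDegree_derivative_le f.derivative.derivative.reverse
    have h₂ := reverse_natDegree_le f.derivative.derivative
    lia
  obtain ⟨u₁, u₂, u₃⟩ := cubic_coeff_ineqs hg gd (by
    intro k hk
    interval_cases k <;> simp only [g0, g1, g2, g3] <;> positivity)
  rw [g0, g1, g2, g3] at u₁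
  rw [g1, g2, g3] at u₂
  rw [g0, g1, g2, g3] at u₃
  -- the cubic carrying the coefficients of degrees `0, …, 3`
  have hh := splits_reverse (splits_derivative (splits_derivative (splits_derivative
    (splits_reverse hf))))
  have c3 (k : ℕ) (hk : k ≤ 3) : f.reverse.derivative.derivative.derivative.coeff k
      = f.coeff (3 - k) * (k + 3) * (k + 2) * (k + 1) := by
    rw [coeff_derivative, coeff_derivative, coeff_derivative, coeff_reverse, hd,
      revAt_le (by lia)]
    interval_cases k <;> norm_num
  have dr : f.reverse.derivative.derivative.derivative.natDegree = 3 := by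
    refine natDegree_eq_of_coeff_pos ?_ ?_
    · have h₁ := natDegree_derivative_le f.reverse
      have h₂ := natDegree_derivative_le f.reverse.derivative
      have h₃ := natDegree_derivative_le f.reverse.derivative.derivative
      have h₄ := reverse_natDegree_le f
      lia
    · rw [c3 3 le_rfl]; norm_num; positivity
  have k0 : f.reverse.derivative.derivative.derivative.reverse.coeff 0 = 120 * f.coeff 0 := by
    rw [coeff_reverse, dr, revAt_le (by norm_num), c3 _ (by norm_num)]; norm_num; ring
  have k1 : f.reverse.derivative.derivative.derivative.reverse.coeff 1 = 60 * f.coeff 1 := by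
    rw [coeff_reverse, dr, revAt_le (by norm_num), c3 _ (by norm_num)]; norm_num; ring
  have k2 : f.reverse.derivative.derivative.derivative.reverse.coeff 2 = 24 * f.coeff 2 := by
    rw [coeff_reverse, dr, revAt_le (by norm_num), c3 _ (by norm_num)]; norm_num; ring
  have k3 : f.reverse.derivative.derivative.derivative.reverse.coeff 3 = 6 * f.coeff 3 := by
    rw [coeff_reverse, dr, revAt_le (by norm_num), c3 _ (by norm_num)]; norm_num; ring
  have kd : f.reverse.derivative.derivative.derivative.reverse.natDegree = 3 := by
    refine natDegree_eq_of_coeff_pos ?_ (by rw [k3]; positivity)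
    exact (reverse_natDegree_le _).trans dr.le
  obtain ⟨v₁, v₂, -⟩ := cubic_coeff_ineqs hh kd (by
    intro k hk
    interval_cases k <;> simp only [k0, k1, k2, k3] <;> positivity)
  rw [k0, k1, k2, k3] at v₁
  rw [k1, k2, k3] at v₂
  have w₁ := mul_pos p5 p2
  refine ⟨by linarith, by linarith [mul_pos p1 p3], ?_, ?_⟩
  · have := mul_le_mul_of_nonneg_right u₂ p3.le
    linarith [pow_pos p3 3]
  · have := mul_le_mul_of_nonneg_right v₂ p2.le
    linarith [pow_pos p2 3]

/-- With `y = √(r₀ / r₂)`, positivity at `y` gives `r₁ > -2 * y * r₂`, so `c₅` makes `q₅ * y ^ 2 - 2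
* q₄ * y + q₃` negative. That quadratic is nonnegative for `y ≤ q₂ / q₃`, while the one governing
the conclusion is nonnegative for `y ≥ q₂ / q₃`. -/
theorem quadratic_core {q₀ q₁ q₂ q₃ q₄ q₅ r₀ r₁ r₂ : ℝ} (h₂ : 0 < q₂) (h₃ : 0 < q₃)
    (h₄ : 0 < q₄) (h₅ : 0 < q₅) (h₁ : 0 < q₁)
    (i₁ : q₅ * q₂ ≤ q₄ * q₃) (i₂ : q₁ * q₃ ≤ q₂ ^ 2)
    (i₃ : 0 ≤ q₅ * q₂ ^ 2 - 2 * (q₄ * q₃ * q₂) + q₃ ^ 3)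
    (i₄ : 0 ≤ q₂ ^ 3 - 2 * (q₁ * q₂ * q₃) + q₀ * q₃ ^ 2) (hr₀ : 0 < r₀) (hr₂ : 0 < r₂)
    (hR : ∀ t : ℝ, 0 < t → 0 < r₂ * t ^ 2 + r₁ * t + r₀)
    (c₅ : q₅ * r₀ + q₄ * r₁ + q₃ * r₂ < 0) : 0 < q₂ * r₀ + q₁ * r₁ + q₀ * r₂ := by
  obtain ⟨y, hy, rfl⟩ : ∃ y : ℝ, 0 < y ∧ r₀ = r₂ * y ^ 2 := by
    refine ⟨√(r₀ / r₂), Real.sqrt_pos.2 (by positivity), ?_⟩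
    rw [Real.sq_sqrt (by positivity)]; field_simp
  have hr₁ : 0 < r₁ + 2 * y * r₂ := by
    refine pos_of_mul_pos_right (a := y) ?_ hy.le
    linarith [hR y hy]
  have k₁ : q₅ * y ^ 2 - 2 * q₄ * y + q₃ < 0 := by
    refine neg_of_mul_neg_right (a := r₂) ?_ hr₂.le
    linarith [mul_pos h₄ hr₁]
  have hz : q₂ < q₃ * y := by
    by_contra! h
    -- Taylor expansion of the quadratic about `q₂ / q₃`.
    have e : q₃ ^ 2 * (q₅ * y ^ 2 - 2 * q₄ * y + q₃) =
        (q₅ * q₂ ^ 2 - 2 * (q₄ * q₃ * q₂) + q₃ ^ 3) + 2 * ((q₂ - q₃ * y) * (q₄ * q₃ - q₅ * q₂))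
          + q₅ * (q₂ - q₃ * y) ^ 2 := by ring
    have h1 := mul_nonneg (sub_nonneg.2 h) (sub_nonneg.2 i₁)
    have h2 : 0 ≤ q₅ * (q₂ - q₃ * y) ^ 2 := by positivity
    have h3 := mul_neg_of_pos_of_neg (pow_pos h₃ 2) k₁
    linarith
  have k₂ : 0 ≤ q₂ * y ^ 2 - 2 * q₁ * y + q₀ := by
    refine nonneg_of_mul_nonneg_right (a := q₃ ^ 2) ?_ (by positivity)
    have e : q₃ ^ 2 * (q₂ * y ^ 2 - 2 * q₁ * y + q₀) =
        (q₂ ^ 3 - 2 * (q₁ * q₂ * q₃) + q₀ * q₃ ^ 2) + 2 * ((q₃ * y - q₂) * (q₂ ^ 2 - q₁ * q₃))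
          + q₂ * (q₃ * y - q₂) ^ 2 := by ring
    rw [e]
    have h1 := mul_nonneg (sub_nonneg.2 hz.le) (sub_nonneg.2 i₂)
    have h2 : 0 ≤ q₂ * (q₃ * y - q₂) ^ 2 := by positivity
    linarith
  linarith [mul_pos h₁ hr₁, mul_nonneg hr₂.le k₂]

/-! ### Splitting off the prescribed roots -/

theorem eval_pos_of_no_root {P : ℝ[X]} {s : Set ℝ} (hs : s.OrdConnected) (h0 : (0 : ℝ) ∈ s)
    (hP : 0 < P.coeff 0) (hroot : ∀ x ∈ s, ¬ P.IsRoot x) {x : ℝ} (hx : x ∈ s) :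
    0 < P.eval x := by
  by_contra! h
  rw [coeff_zero_eq_eval_zero] at hP
  obtain ⟨y, hy, hy'⟩ := intermediate_value_uIcc (a := x) (b := 0) (f := fun x ↦ P.eval x)
    P.continuous.continuousOn (Set.mem_uIcc.2 (Or.inl ⟨h, hP.le⟩))
  exact hroot y (hs.uIcc_subset hx h0 hy) hy'

theorem exists_strictMono_prod_dvd {P : ℝ[X]} (hP : P ≠ 0) {n : ℕ} (p : ℝ → Prop)
    (h : {x : ℝ | p x ∧ P.IsRoot x}.ncard = n) :
    ∃ a : Fin n → ℝ, StrictMono a ∧ (∀ i, p (a i)) ∧ ∏ i, (X - C (a i)) ∣ P := by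
  have hfin : {x : ℝ | p x ∧ P.IsRoot x}.Finite :=
    (finite_setOfPred_isRoot hP).subset fun x hx ↦ hx.2
  obtain ⟨s, hs⟩ := hfin.exists_finset_coe
  rw [← hs, Set.ncard_coe_finset] at h
  have hmem (i : Fin n) : p (s.orderEmbOfFin h i) ∧ P.IsRoot (s.orderEmbOfFin h i) := by
    have := s.orderEmbOfFin_mem h i
    rwa [← Finset.mem_coe, hs] at this
  refine ⟨s.orderEmbOfFin h, (s.orderEmbOfFin h).strictMono, fun i ↦ (hmem i).1, ?_⟩
  refine Finset.prod_dvd_of_coprime (fun i _ j _ hij ↦ ?_) fun i _ ↦ dvd_iff_isRoot.2 (hmem i).2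
  exact pairwise_coprime_X_sub_C (s.orderEmbOfFin h).injective hij

theorem not_isRoot_of_ncard_eq_zero {P : ℝ[X]} (hP : P ≠ 0) {p : ℝ → Prop}
    (h : {x : ℝ | p x ∧ P.IsRoot x}.ncard = 0) {x : ℝ} (hx : p x) : ¬ P.IsRoot x := by
  -- An infinite set also has `ncard` equal to `0`, so finiteness must come first.
  have hfin : {x : ℝ | p x ∧ P.IsRoot x}.Finite :=
    (finite_setOfPred_isRoot hP).subset fun x hx ↦ hx.2
  rw [Set.ncard_eq_zero hfin] at h
  intro hr
  exact (h ▸ (⟨hx, hr⟩ : x ∈ {x : ℝ | p x ∧ P.IsRoot x}) : x ∈ (∅ : Set ℝ))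

/-- The coefficients of an octic with four distinct positive roots and no negative root, in terms
of the elementary symmetric functions of the four roots and of the coefficients of the cofactor. -/
theorem octic_factor {P : ℝ[X]} (hd : P.natDegree = 8) (h0 : 0 < P.coeff 0)
    (hp : {x : ℝ | 0 < x ∧ P.IsRoot x}.ncard = 4) (hn : {x : ℝ | x < 0 ∧ P.IsRoot x}.ncard = 0) :
    ∃ a b c d r₀ r₁ r₂ r₃ r₄ s₁ s₂ s₃ s₄ : ℝ, 0 < a ∧ a < b ∧ b < c ∧ c < d ∧
      s₁ = a + b + c + d ∧ s₂ = a * b + a * c + a * d + b * c + b * d + c * d ∧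
      s₃ = a * b * c + a * b * d + a * c * d + b * c * d ∧ s₄ = a * b * c * d ∧
      (∀ t : ℝ, 0 < t → 0 < r₄ * t ^ 4 - r₃ * t ^ 3 + r₂ * t ^ 2 - r₁ * t + r₀) ∧
      P.coeff 0 = s₄ * r₀ ∧
      P.coeff 1 = s₄ * r₁ - s₃ * r₀ ∧
      P.coeff 2 = s₂ * r₀ - s₃ * r₁ + s₄ * r₂ ∧
      P.coeff 4 = r₀ - s₁ * r₁ + s₂ * r₂ - s₃ * r₃ + s₄ * r₄ ∧
      P.coeff 5 = r₁ - s₁ * r₂ + s₂ * r₃ - s₃ * r₄ ∧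
      P.coeff 7 = r₃ - s₁ * r₄ ∧ P.coeff 8 = r₄ := by
  have hP : P ≠ 0 := by rintro rfl; simp at h0
  obtain ⟨x, hx, hx0, R, hR⟩ := exists_strictMono_prod_dvd hP _ hp
  obtain ⟨a, ha⟩ : ∃ a, a = x 0 := ⟨_, rfl⟩
  obtain ⟨b, hb⟩ : ∃ b, b = x 1 := ⟨_, rfl⟩
  obtain ⟨c, hc⟩ : ∃ c, c = x 2 := ⟨_, rfl⟩
  obtain ⟨d, hd'⟩ : ∃ d, d = x 3 := ⟨_, rfl⟩
  have hab : a < b := ha ▸ hb ▸ hx (by decide)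
  have hbc : b < c := hb ▸ hc ▸ hx (by decide)
  have hcd : c < d := hc ▸ hd' ▸ hx (by decide)
  have ha0 : 0 < a := ha ▸ hx0 0
  have hneg (t : ℝ) (ht : t < 0) : 0 < P.eval t :=
    eval_pos_of_no_root Set.ordConnected_Iic (Set.mem_Iic.2 le_rfl) h0 (fun y hy ↦ by
      rcases (Set.mem_Iic.1 hy).lt_or_eq with h | rfl
      · exact not_isRoot_of_ncard_eq_zero hP hn h
      · rw [IsRoot, ← coeff_zero_eq_eval_zero]; exact h0.ne') (Set.mem_Iic.2 ht.le)
  rw [Fin.prod_univ_four, ← ha, ← hb, ← hc, ← hd'] at hR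
  have hRd : R.natDegree = 4 := by
    have hR0 : R ≠ 0 := by rintro rfl; simp [hP] at hR
    have := congrArg natDegree hR
    rw [natDegree_mul (by simp [X_sub_C_ne_zero]) hR0, natDegree_mul, natDegree_mul, natDegree_mul]
      at this <;> simp [X_sub_C_ne_zero] at this ⊢
    lia
  have hRs := R.as_sum_range_C_mul_X_pow
  rw [hRd] at hRs
  simp only [Finset.sum_range_succ, Finset.sum_range_zero, zero_add, pow_zero, mul_one, pow_one]
    at hRs
  set r₀ := R.coeff 0
  set r₁ := R.coeff 1
  set r₂ := R.coeff 2
  set r₃ := R.coeff 3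
  set r₄ := R.coeff 4
  obtain ⟨s₁, e₁⟩ : ∃ s, s = a + b + c + d := ⟨_, rfl⟩
  obtain ⟨s₂, e₂⟩ : ∃ s, s = a * b + a * c + a * d + b * c + b * d + c * d := ⟨_, rfl⟩
  obtain ⟨s₃, e₃⟩ : ∃ s, s = a * b * c + a * b * d + a * c * d + b * c * d := ⟨_, rfl⟩
  obtain ⟨s₄, e₄⟩ : ∃ s, s = a * b * c * d := ⟨_, rfl⟩
  refine ⟨a, b, c, d, r₀, r₁, r₂, r₃, r₄, s₁, s₂, s₃, s₄, ha0, hab, hbc, hcd, e₁, e₂, e₃, e₄, ?_⟩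
  constructor
  · intro t ht
    have h := hneg (-t) (by linarith)
    rw [hR, eval_mul] at h
    have hQ : 0 < ((X - C a) * (X - C b) * (X - C c) * (X - C d)).eval (-t) := by
      simp only [eval_mul, eval_sub, eval_X, eval_C]
      have : 0 < (t + a) * (t + b) * (t + c) * (t + d) :=
        mul_pos (mul_pos (mul_pos (by linarith) (by linarith)) (by linarith)) (by linarith)
      linarith
    have h' := pos_of_mul_pos_right h hQ.le
    rw [hRs] at h'
    simp only [eval_add, eval_mul, eval_C, eval_pow, eval_X] at h'
    linarith
  have hPs : P = C r₄ * X ^ 8 + C (r₃ - s₁ * r₄) * X ^ 7 + C (r₂ - s₁ * r₃ + s₂ * r₄) * X ^ 6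
      + C (r₁ - s₁ * r₂ + s₂ * r₃ - s₃ * r₄) * X ^ 5
      + C (r₀ - s₁ * r₁ + s₂ * r₂ - s₃ * r₃ + s₄ * r₄) * X ^ 4
      + C (-s₁ * r₀ + s₂ * r₁ - s₃ * r₂ + s₄ * r₃) * X ^ 3
      + C (s₂ * r₀ - s₃ * r₁ + s₄ * r₂) * X ^ 2 + C (s₄ * r₁ - s₃ * r₀) * X + C (s₄ * r₀) := by
    rw [hR, hRs, e₁, e₂, e₃, e₄]
    simp only [map_add, map_sub, map_mul, map_neg]
    ring
  rw [hPs]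
  simp only [coeff_add, coeff_C_mul, coeff_X_pow, coeff_X, coeff_C]
  norm_num

/-! ### Forced coefficient signs and the six cases -/

theorem coeff_four_pos_of_coeff_one_seven {P : ℝ[X]} (hd : P.natDegree = 8)
    (hp : {x : ℝ | 0 < x ∧ P.IsRoot x}.ncard = 4) (hn : {x : ℝ | x < 0 ∧ P.IsRoot x}.ncard = 0)
    (h0 : 0 < P.coeff 0) (h1 : 0 < P.coeff 1) (h7 : 0 < P.coeff 7) (h8 : 0 < P.coeff 8) :
    0 < P.coeff 4 := by
  obtain ⟨a, b, c, d, r₀, r₁, r₂, r₃, r₄, s₁, s₂, s₃, s₄, ha, hab, hbc, hcd, e₁, e₂, e₃, e₄, hR,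
    c0, c1, -, c4, -, c7, c8⟩ := octic_factor hd h0 hp hn
  have hb := ha.trans hab
  have hc := hb.trans hbc
  have hd := hc.trans hcd
  have p₄ : 0 < s₄ := by rw [e₄]; positivity
  rw [c4]
  refine quartic_core_sqrt (by rw [e₁]; positivity) (by rw [e₂]; positivity)
    (by rw [e₃]; positivity) p₄ ?_ ?_ ?_ (pos_of_mul_pos_right (c0 ▸ h0) p₄.le) (c8 ▸ h8) hR
    (c7 ▸ h7) (c1 ▸ h1)
  · rw [e₁, e₂, e₃]
    nlinarith [sq_nonneg (a * b + c * d - a * c - b * d), sq_nonneg (a * b + c * d - a * d - b * c),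
      sq_nonneg (a * c + b * d - a * d - b * c), sq_nonneg (a * b - c * d),
      sq_nonneg (a * c - b * d), sq_nonneg (a * d - b * c)]
  · rw [e₁, e₂]
    linarith [sq_nonneg (a - b), sq_nonneg (a - c), sq_nonneg (a - d), sq_nonneg (b - c),
      sq_nonneg (b - d), sq_nonneg (c - d)]
  · rw [e₂, e₃, e₄]
    linarith [sq_nonneg (a * b * c - a * b * d), sq_nonneg (a * b * c - a * c * d),
      sq_nonneg (a * b * c - b * c * d), sq_nonneg (a * b * d - a * c * d),
      sq_nonneg (a * b * d - b * c * d), sq_nonneg (a * c * d - b * c * d)]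

theorem coeff_two_pos_of_coeff_four_five_seven {P : ℝ[X]} (hd : P.natDegree = 8)
    (hp : {x : ℝ | 0 < x ∧ P.IsRoot x}.ncard = 4) (hn : {x : ℝ | x < 0 ∧ P.IsRoot x}.ncard = 0)
    (h0 : 0 < P.coeff 0) (h4 : P.coeff 4 < 0) (h5 : 0 < P.coeff 5) (h7 : 0 < P.coeff 7)
    (h8 : 0 < P.coeff 8) : 0 < P.coeff 2 := by
  obtain ⟨a, b, c, d, r₀, r₁, r₂, r₃, r₄, s₁, s₂, s₃, s₄, ha, hab, hbc, hcd, e₁, e₂, e₃, e₄, hR,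
    -, -, c2, c4, c5, c7, c8⟩ := octic_factor hd h0 hp hn
  have hb := ha.trans hab
  have hc := hb.trans hbc
  have hd := hc.trans hcd
  obtain ⟨hM, hE⟩ := quartic_esymm_ineq ha hab hbc hcd e₁ e₂ e₃ e₄
  rw [c2]
  refine quartic_core_ratio (by rw [e₁]; positivity) (by rw [e₂]; positivity)
    (by rw [e₄]; positivity) (c8 ▸ h8) ?_ ?_ ?_ hM hE hR (c7 ▸ h7) (c5 ▸ h5) (c4 ▸ h4)
  · rw [e₁, e₂]; ring_nf; positivity
  · rw [e₁, e₂, e₃]; ring_nf; positivity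
  · rw [e₁, e₂, e₃, e₄]; ring_nf; positivity

theorem coeff_two_pos_of_coeff_five {P : ℝ[X]} (hd : P.natDegree = 8)
    (hp : {x : ℝ | 0 < x ∧ P.IsRoot x}.ncard = 0) (hn : {x : ℝ | x < 0 ∧ P.IsRoot x}.ncard = 6)
    (h0 : 0 < P.coeff 0) (h5 : P.coeff 5 < 0) (h8 : 0 < P.coeff 8) : 0 < P.coeff 2 := by
  have hP : P ≠ 0 := by rintro rfl; simp at h0
  obtain ⟨x, hx, hx0, R, hR⟩ := exists_strictMono_prod_dvd hP _ hn
  set Q : ℝ[X] := ∏ i, (X - C (x i)) with hQ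
  have hQm : Q.Monic := monic_prod_of_monic _ _ fun i _ ↦ monic_X_sub_C _
  have hQd : Q.natDegree = 6 := by
    rw [hQ, natDegree_prod_of_monic _ _ fun i _ ↦ monic_X_sub_C _]; simp
  have hQs : Q.Splits := Splits.prod fun i _ ↦ Splits.X_sub_C _
  have hQpos (k : ℕ) (hk : k ≤ 6) : 0 < Q.coeff k := by
    have : Q = ∏ i, (X + C (-x i)) := by simp [hQ, sub_eq_add_neg]
    rw [this, Finset.prod_X_add_C_coeff _ _ (by simpa using hk)]
    refine Finset.sum_pos (fun t _ ↦ Finset.prod_pos fun i _ ↦ neg_pos.2 (hx0 i)) ?_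
    exact Finset.powersetCard_nonempty.2 (by simp)
  obtain ⟨i₁, i₂, i₃, i₄⟩ := sextic_coeff_ineqs hQs hQd hQpos
  have hR0 : R ≠ 0 := by rintro rfl; simp [hP] at hR
  have hRd : R.natDegree = 2 := by
    have := congrArg natDegree hR
    rw [hQm.natDegree_mul' hR0] at this
    lia
  have hQ7 (k : ℕ) (hk : 6 < k) : Q.coeff k = 0 := coeff_eq_zero_of_natDegree_lt (hQd ▸ hk)
  have hR3 (k : ℕ) (hk : 2 < k) : R.coeff k = 0 := coeff_eq_zero_of_natDegree_lt (hRd ▸ hk)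
  have hQ6 : Q.coeff 6 = 1 := by rw [← hQd]; exact hQm.coeff_natDegree
  have c (k : ℕ) : P.coeff k = ∑ i ∈ Finset.range (k + 1), Q.coeff i * R.coeff (k - i) := by
    rw [hR, coeff_mul, Finset.Nat.sum_antidiagonal_eq_sum_range_succ_mk]
  have c0 := c 0
  have c2 := c 2
  have c5 := c 5
  have c8 := c 8
  simp [Finset.sum_range_succ, hR3, hQ7, hQ6] at c0 c2 c5 c8
  have hpos (t : ℝ) (ht : 0 < t) : 0 < P.eval t :=
    eval_pos_of_no_root Set.ordConnected_Ici (Set.mem_Ici.2 le_rfl) h0 (fun y hy ↦ by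
      rcases (Set.mem_Ici.1 hy).lt_or_eq with h | rfl
      · exact not_isRoot_of_ncard_eq_zero hP hp h
      · rw [IsRoot, ← coeff_zero_eq_eval_zero]; exact h0.ne') (Set.mem_Ici.2 ht.le)
  have hRpos (t : ℝ) (ht : 0 < t) : 0 < R.coeff 2 * t ^ 2 + R.coeff 1 * t + R.coeff 0 := by
    have h := hpos t ht
    rw [hR, eval_mul] at h
    have hQt : 0 < Q.eval t := by
      rw [hQ, eval_prod]
      exact Finset.prod_pos fun i _ ↦ by simpa using (hx0 i).trans ht
    have h' := pos_of_mul_pos_right h hQt.le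
    rw [eval_eq_sum_range, hRd] at h'
    simp [Finset.sum_range_succ] at h'
    linarith
  have r₀ : 0 < R.coeff 0 := pos_of_mul_pos_right (c0 ▸ h0) (hQpos 0 (by simp)).le
  have key := quadratic_core (hQpos 2 (by simp)) (hQpos 3 (by simp)) (hQpos 4 (by simp))
    (hQpos 5 (by simp)) (hQpos 1 (by simp)) i₁ i₂ i₃ i₄ r₀ (c8 ▸ h8) hRpos (by linarith)
  linarith

theorem mainTheorem1 :
    ¬ octicCase1.Realizable ∧ ¬ octicCase2.Realizable ∧ ¬ octicCase3.Realizable ∧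
      ¬ octicCase4.Realizable ∧ ¬ octicCase5.Realizable ∧ ¬ octicCase6.Realizable := by
  refine ⟨?_, ?_, ?_, ?_, ?_, ?_⟩ <;> rintro ⟨P, ⟨hd, hs⟩, hp, hn⟩
  -- Patterns list the leading coefficient first, so `hs j` concerns degree `8 - j`.
  · have h0 : 0 < P.coeff 0 := sign_eq_one_iff.1 (by simpa [octicCase1] using hs 8)
    have h2 : P.coeff 2 < 0 := sign_eq_neg_one_iff.1 (by simpa [octicCase1] using hs 6)
    have h5 : P.coeff 5 < 0 := sign_eq_neg_one_iff.1 (by simpa [octicCase1] using hs 3)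
    have h8 : 0 < P.coeff 8 := sign_eq_one_iff.1 (by simpa [octicCase1] using hs 0)
    exact (coeff_two_pos_of_coeff_five hd hp hn h0 h5 h8).not_gt h2
  · have h0 : 0 < P.coeff 0 := sign_eq_one_iff.1 (by simpa [octicCase2] using hs 8)
    have h1 : 0 < P.coeff 1 := sign_eq_one_iff.1 (by simpa [octicCase2] using hs 7)
    have h4 : P.coeff 4 < 0 := sign_eq_neg_one_iff.1 (by simpa [octicCase2] using hs 4)
    have h7 : 0 < P.coeff 7 := sign_eq_one_iff.1 (by simpa [octicCase2] using hs 1)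
    have h8 : 0 < P.coeff 8 := sign_eq_one_iff.1 (by simpa [octicCase2] using hs 0)
    exact (coeff_four_pos_of_coeff_one_seven hd hp hn h0 h1 h7 h8).not_gt h4
  · have h0 : 0 < P.coeff 0 := sign_eq_one_iff.1 (by simpa [octicCase3] using hs 8)
    have h2 : P.coeff 2 < 0 := sign_eq_neg_one_iff.1 (by simpa [octicCase3] using hs 6)
    have h4 : P.coeff 4 < 0 := sign_eq_neg_one_iff.1 (by simpa [octicCase3] using hs 4)
    have h5 : 0 < P.coeff 5 := sign_eq_one_iff.1 (by simpa [octicCase3] using hs 3)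
    have h7 : 0 < P.coeff 7 := sign_eq_one_iff.1 (by simpa [octicCase3] using hs 1)
    have h8 : 0 < P.coeff 8 := sign_eq_one_iff.1 (by simpa [octicCase3] using hs 0)
    exact (coeff_two_pos_of_coeff_four_five_seven hd hp hn h0 h4 h5 h7 h8).not_gt h2
  · have h0 : 0 < P.coeff 0 := sign_eq_one_iff.1 (by simpa [octicCase4] using hs 8)
    have h1 : 0 < P.coeff 1 := sign_eq_one_iff.1 (by simpa [octicCase4] using hs 7)
    have h4 : P.coeff 4 < 0 := sign_eq_neg_one_iff.1 (by simpa [octicCase4] using hs 4)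
    have h7 : 0 < P.coeff 7 := sign_eq_one_iff.1 (by simpa [octicCase4] using hs 1)
    have h8 : 0 < P.coeff 8 := sign_eq_one_iff.1 (by simpa [octicCase4] using hs 0)
    exact (coeff_four_pos_of_coeff_one_seven hd hp hn h0 h1 h7 h8).not_gt h4
  · have h0 : 0 < P.coeff 0 := sign_eq_one_iff.1 (by simpa [octicCase5] using hs 8)
    have h2 : P.coeff 2 < 0 := sign_eq_neg_one_iff.1 (by simpa [octicCase5] using hs 6)
    have h4 : P.coeff 4 < 0 := sign_eq_neg_one_iff.1 (by simpa [octicCase5] using hs 4)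
    have h5 : 0 < P.coeff 5 := sign_eq_one_iff.1 (by simpa [octicCase5] using hs 3)
    have h7 : 0 < P.coeff 7 := sign_eq_one_iff.1 (by simpa [octicCase5] using hs 1)
    have h8 : 0 < P.coeff 8 := sign_eq_one_iff.1 (by simpa [octicCase5] using hs 0)
    exact (coeff_two_pos_of_coeff_four_five_seven hd hp hn h0 h4 h5 h7 h8).not_gt h2
  · have h0 : 0 < P.coeff 0 := sign_eq_one_iff.1 (by simpa [octicCase6] using hs 8)
    have h2 : P.coeff 2 < 0 := sign_eq_neg_one_iff.1 (by simpa [octicCase6] using hs 6)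
    have h4 : P.coeff 4 < 0 := sign_eq_neg_one_iff.1 (by simpa [octicCase6] using hs 4)
    have h5 : 0 < P.coeff 5 := sign_eq_one_iff.1 (by simpa [octicCase6] using hs 3)
    have h7 : 0 < P.coeff 7 := sign_eq_one_iff.1 (by simpa [octicCase6] using hs 1)
    have h8 : 0 < P.coeff 8 := sign_eq_one_iff.1 (by simpa [octicCase6] using hs 0)
    exact (coeff_two_pos_of_coeff_four_five_seven hd hp hn h0 h4 h5 h7 h8).not_gt h2
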